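/- Let $(R,\mathfrak m)$ be a commutative noetherian local ring and let $\underline{x}=x_1,\dots,x_n$ ($n\ge 0$) be an $R$-regular sequence; that is, $x_i$ is a non-zero-divisor on $R/(x_1,\dots,x_{i-1})$ for every $i=1,\dots,n$, and $R/(\underline{x})\neq 0$. For a commutative noetherian local ring $S$, consider the following property: (TG) Every finitely generated $S$-module $M$ satisfying $\operatorname{Tor}^S_i(M,M)=0$ for all $i\gg 0$ has finite G-dimension over $S$. Here a finitely generated $S$-module $M$ has finite G-dimension if, for some $m\ge 0$, there is an exact sequence $0\to G_m\to\cdots\to G_0\to M\to 0$ in which every $G_j$ is a finitely generated $S$-module such that $\operatorname{Ext}_S^i(G_j,S)=0=\operatorname{Ext}_S^i(\operatorname{Hom}_S(G_j,S),S)$ for all $i>0$ and the biduality map $G_j\to\operatorname{Hom}_S(\operatorname{Hom}_S(G_j,S),S)$ is an isomorphism. Then $R$ has the property (TG) if and only if $R/(\underline{x})$ has the property (TG). -/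

import Mathlib

open CategoryTheory

universe u

/-- The G-class of `R`: a finitely generated module `M` is totally reflexive (that is, zero or of
G-dimension `0`) if `Ext^i_R(M, R) = 0` and `Ext^i_R(Hom_R(M, R), R) = 0` for all `i > 0`, and the
biduality map `M → Hom_R(Hom_R(M, R), R)` is bijective (`Module.IsReflexive`). -/
structure IsTotallyReflexive (R : Type u) [CommRing R] (M : Type u) [AddCommGroup M] [Module R M] :
    Prop where
  finite : Module.Finite R M
  ext_eq_zero : ∀ i : ℕ, 0 < i →
    Subsingleton (Abelian.Ext.{u} (ModuleCat.of R M) (ModuleCat.of R R) i)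
  ext_dual_eq_zero : ∀ i : ℕ, 0 < i →
    Subsingleton (Abelian.Ext.{u} (ModuleCat.of R (Module.Dual R M)) (ModuleCat.of R R) i)
  reflexive : Module.IsReflexive R M

/-- `HasGDimLE R n M`: there is an exact sequence `0 → Gₙ → ⋯ → G₁ → G₀ → M → 0` with all `Gᵢ`
totally reflexive. It is built one short exact sequence `0 → K → G₀ → M → 0` at a time. -/
inductive HasGDimLE (R : Type u) [CommRing R] :
    ℕ → (M : Type u) → [AddCommGroup M] → [Module R M] → Prop
  | zero (M : Type u) [AddCommGroup M] [Module R M] (h : IsTotallyReflexive R M) :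
      HasGDimLE R 0 M
  | succ (n : ℕ) (K G M : Type u) [AddCommGroup K] [Module R K] [AddCommGroup G] [Module R G]
      [AddCommGroup M] [Module R M] (f : K →ₗ[R] G) (g : G →ₗ[R] M)
      (hf : Function.Injective f) (hfg : Function.Exact f g) (hg : Function.Surjective g)
      (hG : IsTotallyReflexive R G) (hK : HasGDimLE R n K) :
      HasGDimLE R (n + 1) M

/-- `M` has finite G-dimension over `R`: it has a resolution of finite length by totally
reflexive modules. -/
def HasFiniteGDim (R : Type u) [CommRing R] (M : Type u) [AddCommGroup M] [Module R M] : Prop :=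
  ∃ n : ℕ, HasGDimLE R n M

/-- The property (TG): every finitely generated `R`-module `M` with `Tor_i^R(M, M) = 0` for all
`i ≫ 0` has finite G-dimension. -/
def PropertyTG (R : Type u) [CommRing R] : Prop :=
  ∀ (M : Type u) [AddCommGroup M] [Module R M], Module.Finite R M →
    (∃ n : ℕ, ∀ i : ℕ, n ≤ i →
      Limits.IsZero
        (((Tor (ModuleCat.{u} R) i).obj (ModuleCat.of R M)).obj (ModuleCat.of R M))) →
    HasFiniteGDim R M

/-! By induction on the length of the sequence it suffices to treat one regular element `x` in the
Jacobson radical, with `S = R/x`. Writing `N^∨` for the character module, Tor vanishing is traded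
for Ext vanishing: `Tor_i(M, N) = 0` iff `Ext^i(N, M^∨) = 0` for `i > 0` (`isZero_tor_succ_iff`).
The bridge between the rings is `IsReduction.extVanishes_iff`: if `x` is regular on `N`, then
`Ext_R(N, W)` and `Ext_S(N/xN, W)` vanish in the same positive degrees for every `S`-module `W`.

From `S` to `R`: a syzygy `N` of `M` is `x`-regular and inherits the self-vanishing, and so does
`N/xN` over `S`. Hence `N/xN` has finite G-dimension, which lifts to `N` by Nakayama's lemma
(`hasGDimLE_of_reduction`), and then `M` has finite G-dimension too.

From `R` to `S`: for an `S`-module `M` and an `R`-presentation `0 → K → F → M → 0`, reduction modulo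
`x` gives `0 → M → K/xK → F/xF → M → 0`. So `Ext_S(K/xK, M^∨)` is squeezed between two vanishing
groups, `Ext_R(M, M^∨)` vanishes in high degrees, and `M` has finite G-dimension over `R`. To return
to `S`, pass to `S`-syzygies until the `R`-syzygy `K` is totally reflexive. The four-term sequence
then embeds the module in a totally reflexive `K/xK` with cokernel of the same kind, and this
self-reproducing situation forces total reflexivity over `S` (`SyzygyGDimLE.isTotallyReflexive`). -/

open scoped TensorProduct

/-! ### Vanishing of Ext along short exact sequences -/

/-- `Ext^i_R(M, N) = 0`. -/
abbrev ExtVanishes (R : Type u) [CommRing R] (M N : Type u) [AddCommGroup M] [Module R M]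
    [AddCommGroup N] [Module R N] (i : ℕ) : Prop :=
  Subsingleton (Abelian.Ext.{u} (ModuleCat.of R M) (ModuleCat.of R N) i)

namespace ExtVanishes

section

variable {R : Type u} [CommRing R] {A B C N : Type u} [AddCommGroup A] [Module R A]
  [AddCommGroup B] [Module R B] [AddCommGroup C] [Module R C] [AddCommGroup N] [Module R N]
  {f : A →ₗ[R] B} {g : B →ₗ[R] C}

theorem exists_shortExact (hf : Function.Injective f) (hfg : Function.Exact f g)
    (hg : Function.Surjective g) :
    ∃ w, (ShortComplex.mk (ModuleCat.ofHom f) (ModuleCat.ofHom g) w).ShortExact := by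
  refine ⟨by rw [← ModuleCat.ofHom_comp, hfg.linearMap_comp_eq_zero]; rfl, ?_⟩
  have : Mono (ModuleCat.ofHom f) := (ModuleCat.mono_iff_injective _).2 hf
  have : Epi (ModuleCat.ofHom g) := (ModuleCat.epi_iff_surjective _).2 hg
  exact ⟨(ShortComplex.ShortExact.moduleCat_exact_iff_function_exact _).2 hfg⟩

theorem middle (hf : Function.Injective f) (hfg : Function.Exact f g)
    (hg : Function.Surjective g) {i : ℕ} (hA : ExtVanishes R A N i) (hC : ExtVanishes R C N i) :
    ExtVanishes R B N i := by
  obtain ⟨w, hS⟩ := exists_shortExact hf hfg hg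
  refine subsingleton_of_forall_eq 0 fun y => ?_
  obtain ⟨z, rfl⟩ := Abelian.Ext.contravariant_sequence_exact₂ hS _ y (Subsingleton.elim _ _)
  rw [show z = 0 from Subsingleton.elim _ _, Abelian.Ext.comp_zero]

theorem left (hf : Function.Injective f) (hfg : Function.Exact f g)
    (hg : Function.Surjective g) {i : ℕ} (hB : ExtVanishes R B N i)
    (hC : ExtVanishes R C N (i + 1)) : ExtVanishes R A N i := by
  obtain ⟨w, hS⟩ := exists_shortExact hf hfg hg
  refine subsingleton_of_forall_eq 0 fun y => ?_
  obtain ⟨z, rfl⟩ := Abelian.Ext.contravariant_sequence_exact₁ hS _ y (add_comm 1 i)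
    (Subsingleton.elim _ _)
  rw [show z = 0 from Subsingleton.elim _ _, Abelian.Ext.comp_zero]

theorem right (hf : Function.Injective f) (hfg : Function.Exact f g)
    (hg : Function.Surjective g) {i : ℕ} (hA : ExtVanishes R A N i)
    (hB : ExtVanishes R B N (i + 1)) : ExtVanishes R C N (i + 1) := by
  obtain ⟨w, hS⟩ := exists_shortExact hf hfg hg
  refine subsingleton_of_forall_eq 0 fun y => ?_
  obtain ⟨z, rfl⟩ := Abelian.Ext.contravariant_sequence_exact₃ hS _ y (Subsingleton.elim _ _)
    (add_comm 1 i)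
  rw [show z = 0 from Subsingleton.elim _ _, Abelian.Ext.comp_zero]

/-- If `Ext^1(C, N) = 0`, maps to `N` extend along `A → B` with cokernel `C`. -/
theorem exists_extend (hf : Function.Injective f) (hfg : Function.Exact f g)
    (hg : Function.Surjective g) (hC : ExtVanishes R C N 1) (h : A →ₗ[R] N) :
    ∃ h' : B →ₗ[R] N, h' ∘ₗ f = h := by
  obtain ⟨w, hS⟩ := exists_shortExact hf hfg hg
  obtain ⟨z, hz⟩ := Abelian.Ext.contravariant_sequence_exact₁ hS (ModuleCat.of R N)
    (Abelian.Ext.mk₀ (ModuleCat.ofHom h)) (add_zero 1) (Subsingleton.elim _ _)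
  obtain ⟨k, rfl⟩ := Abelian.Ext.homEquiv₀.symm.surjective z
  refine ⟨k.hom, ?_⟩
  have h2 : ModuleCat.ofHom f ≫ k = ModuleCat.ofHom h := by
    apply Abelian.Ext.homEquiv₀.symm.injective
    simpa [Abelian.Ext.homEquiv₀] using hz
  simpa using congrArg ModuleCat.Hom.hom h2

theorem right_one (hf : Function.Injective f) (hfg : Function.Exact f g)
    (hg : Function.Surjective g) (hB : ExtVanishes R B N 1)
    (h : ∀ h : A →ₗ[R] N, ∃ h' : B →ₗ[R] N, h' ∘ₗ f = h) : ExtVanishes R C N 1 := by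
  obtain ⟨w, hS⟩ := exists_shortExact hf hfg hg
  refine subsingleton_of_forall_eq 0 fun y => ?_
  obtain ⟨z, rfl⟩ := Abelian.Ext.contravariant_sequence_exact₃ hS _ y (Subsingleton.elim _ _)
    (add_zero 1)
  obtain ⟨k, rfl⟩ := Abelian.Ext.homEquiv₀.symm.surjective z
  obtain ⟨h', hh⟩ := h k.hom
  have : k = ModuleCat.ofHom f ≫ ModuleCat.ofHom h' := by
    rw [← ModuleCat.ofHom_comp, hh]; rfl
  subst this
  have := hS.extClass_comp_assoc (Abelian.Ext.mk₀ (ModuleCat.ofHom h')) (h := add_zero 1)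
  simpa [Abelian.Ext.homEquiv₀] using this

theorem cov_right (hf : Function.Injective f) (hfg : Function.Exact f g)
    (hg : Function.Surjective g) {i : ℕ} (hB : ExtVanishes R N B i)
    (hA : ExtVanishes R N A (i + 1)) : ExtVanishes R N C i := by
  obtain ⟨w, hS⟩ := exists_shortExact hf hfg hg
  refine subsingleton_of_forall_eq 0 fun y => ?_
  obtain ⟨z, rfl⟩ := Abelian.Ext.covariant_sequence_exact₃ _ hS y rfl
    (Subsingleton.elim _ _)
  rw [show z = 0 from Subsingleton.elim _ _, Abelian.Ext.zero_comp]

theorem cov_left (hf : Function.Injective f) (hfg : Function.Exact f g)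
    (hg : Function.Surjective g) {i : ℕ} (hC : ExtVanishes R N C i)
    (hB : ExtVanishes R N B (i + 1)) : ExtVanishes R N A (i + 1) := by
  obtain ⟨w, hS⟩ := exists_shortExact hf hfg hg
  refine subsingleton_of_forall_eq 0 fun y => ?_
  obtain ⟨z, rfl⟩ := Abelian.Ext.covariant_sequence_exact₁ _ hS y (Subsingleton.elim _ _) rfl
  rw [show z = 0 from Subsingleton.elim _ _, Abelian.Ext.zero_comp]

/-- If `Ext^1(N, A) = 0`, maps from `N` lift along `B → C` with kernel `A`. -/
theorem exists_lift (hf : Function.Injective f) (hfg : Function.Exact f g)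
    (hg : Function.Surjective g) (hA : ExtVanishes R N A 1) (h : N →ₗ[R] C) :
    ∃ h' : N →ₗ[R] B, g ∘ₗ h' = h := by
  obtain ⟨w, hS⟩ := exists_shortExact hf hfg hg
  obtain ⟨z, hz⟩ := Abelian.Ext.covariant_sequence_exact₃ (ModuleCat.of R N) hS
    (Abelian.Ext.mk₀ (ModuleCat.ofHom h)) (zero_add 1) (Subsingleton.elim _ _)
  obtain ⟨k, rfl⟩ := Abelian.Ext.homEquiv₀.symm.surjective z
  refine ⟨k.hom, ?_⟩
  have h2 : k ≫ ModuleCat.ofHom g = ModuleCat.ofHom h := by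
    apply Abelian.Ext.homEquiv₀.symm.injective
    simpa [Abelian.Ext.homEquiv₀] using hz
  simpa using congrArg ModuleCat.Hom.hom h2

theorem of_projective [Module.Projective R A] (i : ℕ) : ExtVanishes R A N (i + 1) :=
  Abelian.Ext.subsingleton_of_projective _ _ _

theorem of_injective [Module.Injective R N] (i : ℕ) : ExtVanishes R A N (i + 1) := by
  have : Injective (ModuleCat.of R N) := Module.injective_object_of_injective_module R N
  exact Abelian.Ext.subsingleton_of_injective _ _ _

theorem congr_left (e : A ≃ₗ[R] B) {i : ℕ} (h : ExtVanishes R A N i) : ExtVanishes R B N i := by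
  have : ExtVanishes R PUnit N i := by
    cases i with
    | zero =>
      exact Abelian.Ext.homEquiv₀.subsingleton_congr.2
        ⟨fun a b => by ext x; rw [Subsingleton.elim x 0, map_zero, map_zero]⟩
    | succ i => exact of_projective i
  -- An isomorphism is a short exact sequence with zero cokernel.
  refine middle (f := e.toLinearMap) (g := (0 : B →ₗ[R] PUnit.{u + 1})) e.injective ?_
    (fun x => ⟨0, rfl⟩)
    h this
  intro x
  simp

/-- Dimension shift along a presentation by a projective module. -/
theorem shift_iff [Module.Projective R B] (hf : Function.Injective f) (hfg : Function.Exact f g)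
    (hg : Function.Surjective g) (i : ℕ) :
    ExtVanishes R C N (i + 2) ↔ ExtVanishes R A N (i + 1) :=
  ⟨fun h => left hf hfg hg (of_projective i) h, fun h => right hf hfg hg h (of_projective (i + 1))⟩

theorem one_iff [Module.Projective R B] (hf : Function.Injective f) (hfg : Function.Exact f g)
    (hg : Function.Surjective g) :
    ExtVanishes R C N 1 ↔ ∀ h : A →ₗ[R] N, ∃ h' : B →ₗ[R] N, h' ∘ₗ f = h :=
  ⟨fun h => exists_extend hf hfg hg h, fun h => right_one hf hfg hg (of_projective 0) h⟩

end

end ExtVanishes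

/-! ### Tor vanishing as Ext vanishing into character modules -/

theorem Function.Exact.comp_surjective_iff_injective {R X Y Z W : Type*} [Ring R]
    [AddCommGroup X] [Module R X] [AddCommGroup Y] [Module R Y] [AddCommGroup Z] [Module R Z]
    [AddCommGroup W] [Module R W] {v : X →ₗ[R] Y} {p : Y →ₗ[R] Z} (h : Function.Exact v p)
    (hp : Function.Surjective p) (w : Z →ₗ[R] W) :
    Function.Exact v (w ∘ₗ p) ↔ Function.Injective w := by
  constructor
  · intro H
    rw [injective_iff_map_eq_zero]
    intro z hz
    obtain ⟨y, rfl⟩ := hp z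
    exact (h y).2 ((H y).1 hz)
  · intro H y
    rw [← h y, LinearMap.comp_apply, map_eq_zero_iff w H]

/-- Let `I` be the image of `d₀`. By right exactness `M ⊗ I` is the cokernel of the tensored `d₁`,
so exactness means that `M ⊗ I → M ⊗ Z` is injective. Dually, every map `I → M^∨` extends to `Z`,
which is the `Ext^1` condition because `Z` is projective. -/
theorem exact_lTensor_iff_extVanishes {R : Type u} [CommRing R] (M : Type u) {X Y Z : Type u}
    [AddCommGroup M] [Module R M] [AddCommGroup X] [Module R X] [AddCommGroup Y] [Module R Y]
    [AddCommGroup Z] [Module R Z] [Module.Projective R Z] {d₁ : X →ₗ[R] Y} {d₀ : Y →ₗ[R] Z}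
    (h : Function.Exact d₁ d₀) :
    Function.Exact (d₁.lTensor M) (d₀.lTensor M) ↔
      ExtVanishes R (Z ⧸ LinearMap.range d₀) (CharacterModule M) 1 := by
  have hr : Function.Exact d₁ d₀.rangeRestrict := fun y => by
    rw [← h y]
    exact ⟨fun H => congrArg Subtype.val H, fun H => Subtype.ext H⟩
  have hex := lTensor_exact M hr d₀.surjective_rangeRestrict
  have := hex.comp_surjective_iff_injective
    (LinearMap.lTensor_surjective M d₀.surjective_rangeRestrict)
    ((LinearMap.range d₀).subtype.lTensor M)
  rw [← LinearMap.lTensor_comp, LinearMap.subtype_comp_codRestrict] at this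
  rw [this, ExtVanishes.one_iff (LinearMap.range d₀).injective_subtype
    (LinearMap.exact_subtype_mkQ _) (Submodule.mkQ_surjective _),
    LinearMap.lTensor_inj_iff_rTensor_inj, rTensor_injective_iff_lcomp_surjective]
  rfl

section

variable {R : Type u} [CommRing R] (M N : Type u) [AddCommGroup M] [Module R M]
  [AddCommGroup N] [Module R N] (P : ProjectiveResolution (ModuleCat.of R N))

/-- The cokernel is the `j`-th syzygy of `N`, so this is dimension shifting. -/
theorem CategoryTheory.ProjectiveResolution.extVanishes_cokernel_iff (W : Type u) [AddCommGroup W]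
    [Module R W] (j k : ℕ) :
    ExtVanishes R (P.complex.X j ⧸ LinearMap.range (P.complex.d (j + 1) j).hom) W (k + 1) ↔
      ExtVanishes R N W (k + j + 1) := by
  induction j generalizing k with
  | zero =>
    have h1 : Function.Exact (P.complex.d 1 0).hom (P.π.f 0).hom :=
      (ShortComplex.ShortExact.moduleCat_exact_iff_function_exact _).1 P.exact₀
    have h2 : Function.Surjective (P.π.f 0).hom := (ModuleCat.epi_iff_surjective _).1 inferInstance
    let e : (P.complex.X 0 ⧸ LinearMap.range (P.complex.d 1 0).hom) ≃ₗ[R] N :=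
      (Submodule.quotEquivOfEq _ _ (LinearMap.exact_iff.1 h1).symm).trans
        ((P.π.f 0).hom.quotKerEquivOfSurjective h2)
    exact ⟨fun h => h.congr_left e, fun h => h.congr_left e.symm⟩
  | succ j ih =>
    have h1 : Function.Exact (P.complex.d (j + 2) (j + 1)).hom (P.complex.d (j + 1) j).hom :=
      (ShortComplex.ShortExact.moduleCat_exact_iff_function_exact _).1 (P.exact_succ j)
    let e := (Submodule.quotEquivOfEq _ _ (LinearMap.exact_iff.1 h1).symm).trans
        (P.complex.d (j + 1) j).hom.quotKerEquivRange
    have : Module.Projective R (P.complex.X j) := inferInstance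
    rw [show k + (j + 1) + 1 = (k + 1) + j + 1 by omega, ← ih (k + 1),
      ExtVanishes.shift_iff (LinearMap.range (P.complex.d (j + 1) j).hom).injective_subtype
        (LinearMap.exact_subtype_mkQ _) (Submodule.mkQ_surjective _)]
    exact ⟨fun h => h.congr_left e, fun h => h.congr_left e.symm⟩

theorem isZero_tor_succ_iff (i : ℕ) :
    Limits.IsZero (((Tor (ModuleCat.{u} R) (i + 1)).obj (ModuleCat.of R M)).obj
      (ModuleCat.of R N)) ↔
      ExtVanishes R N (CharacterModule M) (i + 1) := by
  let P := projectiveResolution (ModuleCat.of R N)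
  have h1 : Function.Exact (P.complex.d (i + 2) (i + 1)).hom (P.complex.d (i + 1) i).hom :=
      (ShortComplex.ShortExact.moduleCat_exact_iff_function_exact _).1 (P.exact_succ i)
  have : Module.Projective R (P.complex.X i) := inferInstance
  have h2 := P.extVanishes_cokernel_iff N (CharacterModule M) i 0
  rw [zero_add, zero_add] at h2
  rw [← h2,
    ← exact_lTensor_iff_extVanishes M h1]
  refine (P.isoLeftDerivedObj _ (i + 1)).isZero_iff.trans ?_
  refine (HomologicalComplex.exactAt_iff_isZero_homology _ _).symm.trans ?_
  rw [HomologicalComplex.exactAt_iff' _ (i + 2) (i + 1) i (by simp) (by simp),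
    ShortComplex.ShortExact.moduleCat_exact_iff_function_exact]
  rfl

end

/-! ### Duality in short exact sequences -/

section

variable {R : Type u} [CommRing R] {A B C X : Type u} [AddCommGroup A] [Module R A]
  [AddCommGroup B] [Module R B] [AddCommGroup C] [Module R C] [AddCommGroup X] [Module R X]
  {f : A →ₗ[R] B} {g : B →ₗ[R] C}

theorem Function.Exact.exists_lift_of_injective (hf : Function.Injective f)
    (hfg : Function.Exact f g) (h : X →ₗ[R] B) (hh : ∀ x, g (h x) = 0) :
    ∃ l : X →ₗ[R] A, ∀ x, f (l x) = h x := by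
  choose l hl using fun x => (hfg (h x)).1 (hh x)
  exact ⟨⟨⟨l, fun x y => hf (by simp [hl])⟩, fun r x => hf (by simp [hl])⟩, hl⟩

theorem Function.Exact.exists_desc_of_surjective (hfg : Function.Exact f g)
    (hg : Function.Surjective g) (h : B →ₗ[R] X) (hh : ∀ a, h (f a) = 0) :
    ∃ l : C →ₗ[R] X, ∀ b, l (g b) = h b := by
  have hk : ∀ b, g b = 0 → h b = 0 := fun b hb => by
    obtain ⟨a, rfl⟩ := (hfg b).1 hb
    exact hh a
  have hk' : ∀ b b', g b = g b' → h b = h b' := fun b b' hb =>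
    sub_eq_zero.1 ((map_sub h b b').symm.trans (hk _ (by rw [map_sub, hb, sub_self])))
  choose s hs using hg
  exact ⟨⟨⟨fun c => h (s c), fun c d => by rw [← map_add]; exact hk' _ _ (by simp [hs])⟩,
    fun r c => by rw [RingHom.id_apply, ← map_smul]; exact hk' _ _ (by simp [hs])⟩,
    fun b => hk' _ _ (hs _)⟩

theorem Function.Exact.dualMap_exact (hfg : Function.Exact f g)
    (hg : Function.Surjective g) : Function.Exact g.dualMap f.dualMap := by
  intro φ
  constructor
  · intro h
    obtain ⟨l, hl⟩ := hfg.exists_desc_of_surjective hg φ fun a => LinearMap.congr_fun h a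
    exact ⟨l, LinearMap.ext hl⟩
  · rintro ⟨ψ, rfl⟩
    ext a
    simp [hfg.apply_apply_eq_zero a]

theorem dualMap_surjective_of_extVanishes (hf : Function.Injective f) (hfg : Function.Exact f g)
    (hg : Function.Surjective g) (hC : ExtVanishes R C R 1) : Function.Surjective f.dualMap :=
  fun h => ExtVanishes.exists_extend hf hfg hg hC h

theorem dual_eval_injective_of_injective (hf : Function.Injective f)
    (hB : Function.Injective (Module.Dual.eval R B)) :
    Function.Injective (Module.Dual.eval R A) := by
  rw [injective_iff_map_eq_zero] at hB ⊢
  intro a ha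
  refine (map_eq_zero_iff f hf).1 (hB _ ?_)
  ext φ
  exact LinearMap.congr_fun ha (φ ∘ₗ f)

/-- In a short exact sequence `0 → A → B → C → 0` with `B` reflexive, `C` torsionless and
`Ext^1(C, R) = 0`, the module `A` is reflexive. -/
theorem isReflexive_of_extVanishes (hf : Function.Injective f) (hfg : Function.Exact f g)
    (hg : Function.Surjective g) (hC : ExtVanishes R C R 1) (hB : Module.IsReflexive R B)
    (hC' : Function.Injective (Module.Dual.eval R C)) : Module.IsReflexive R A := by
  refine ⟨dual_eval_injective_of_injective hf (Module.bijective_dual_eval R B).1, fun ξ => ?_⟩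
  -- Push `ξ` into the bidual of `B`, where it is evaluation at some `b`. Torsionlessness of `C`
  -- puts `b` in `A`, and functionals on `A` extend to `B`.
  obtain ⟨b, hb⟩ := (Module.bijective_dual_eval R B).2 (ξ ∘ₗ f.dualMap)
  have hgb : g b = 0 := by
    refine (map_eq_zero_iff _ hC').1 ?_
    ext ψ
    have h1 := LinearMap.congr_fun hb (ψ ∘ₗ g)
    have h2 : f.dualMap (ψ ∘ₗ g) = 0 := by
      ext a
      simp [hfg.apply_apply_eq_zero a]
    simpa [h2] using h1
  obtain ⟨a, rfl⟩ := (hfg b).1 hgb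
  refine ⟨a, ?_⟩
  ext φ
  obtain ⟨φ', rfl⟩ := dualMap_surjective_of_extVanishes hf hfg hg hC φ
  exact LinearMap.congr_fun hb φ'

/-- In a short exact sequence `0 → A → B → C → 0` with `C` reflexive and `Ext^1(C, R)` and
`Ext^1(B*, R)` zero, also `Ext^1(A*, R) = 0`. -/
theorem extVanishes_dual_one (hf : Function.Injective f) (hfg : Function.Exact f g)
    (hg : Function.Surjective g) (hC : ExtVanishes R C R 1) (hC' : Module.IsReflexive R C)
    (hB : ExtVanishes R (Module.Dual R B) R 1) : ExtVanishes R (Module.Dual R A) R 1 := by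
  refine ExtVanishes.right_one (LinearMap.dualMap_injective_of_surjective hg)
    (hfg.dualMap_exact hg) (dualMap_surjective_of_extVanishes hf hfg hg hC) hB fun h => ?_
  -- A functional on `C*` is evaluation at some `c`; evaluation at a preimage of `c` extends it to
  -- `B*`.
  obtain ⟨c, rfl⟩ := (Module.bijective_dual_eval R C).2 h
  obtain ⟨b, rfl⟩ := hg c
  exact ⟨Module.Dual.eval R B b, rfl⟩

theorem extVanishes_dual_succ (hf : Function.Injective f) (hfg : Function.Exact f g)
    (hg : Function.Surjective g) (hC : ExtVanishes R C R 1) {i : ℕ}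
    (hC' : ExtVanishes R (Module.Dual R C) R i)
    (hB : ExtVanishes R (Module.Dual R B) R (i + 1)) :
    ExtVanishes R (Module.Dual R A) R (i + 1) :=
  ExtVanishes.right (LinearMap.dualMap_injective_of_surjective hg)
    (hfg.dualMap_exact hg) (dualMap_surjective_of_extVanishes hf hfg hg hC) hC' hB

end

/-! ### Totally reflexive modules -/

namespace IsTotallyReflexive

section

variable {R : Type u} [CommRing R] {A B C : Type u} [AddCommGroup A] [Module R A]
  [AddCommGroup B] [Module R B] [AddCommGroup C] [Module R C]
  {f : A →ₗ[R] B} {g : B →ₗ[R] C}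

theorem of_projective [Module.Finite R A] [Module.Projective R A] : IsTotallyReflexive R A where
  finite := inferInstance
  ext_eq_zero
    | i + 1, _ => ExtVanishes.of_projective i
  ext_dual_eq_zero
    | i + 1, _ => ExtVanishes.of_projective i
  reflexive := inferInstance

theorem congr (e : A ≃ₗ[R] B) (h : IsTotallyReflexive R A) : IsTotallyReflexive R B where
  finite := have := h.finite; Module.Finite.equiv e
  ext_eq_zero i hi := ExtVanishes.congr_left e (h.ext_eq_zero i hi)
  ext_dual_eq_zero i hi := ExtVanishes.congr_left e.symm.dualMap (h.ext_dual_eq_zero i hi)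
  reflexive := have := h.reflexive; Module.equiv e

theorem prod (hA : IsTotallyReflexive R A) (hB : IsTotallyReflexive R B) :
    IsTotallyReflexive R (A × B) where
  finite := have := hA.finite; have := hB.finite; inferInstance
  ext_eq_zero i hi := ExtVanishes.middle (LinearMap.inl_injective (R := R) (M := A) (M₂ := B))
    Function.Exact.inl_snd LinearMap.snd_surjective (hA.ext_eq_zero i hi) (hB.ext_eq_zero i hi)
  ext_dual_eq_zero i hi := ExtVanishes.congr_left (Module.dualProdDualEquivDual R A B) <|
    ExtVanishes.middle (LinearMap.inl_injective (R := R) (M := Module.Dual R A)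
      (M₂ := Module.Dual R B)) Function.Exact.inl_snd LinearMap.snd_surjective
      (hA.ext_dual_eq_zero i hi) (hB.ext_dual_eq_zero i hi)
  reflexive := have := hA.reflexive; have := hB.reflexive; inferInstance

theorem ker [IsNoetherianRing R] (hf : Function.Injective f) (hfg : Function.Exact f g)
    (hg : Function.Surjective g) (hB : IsTotallyReflexive R B) (hC : IsTotallyReflexive R C) :
    IsTotallyReflexive R A where
  finite := have := hB.finite; Module.Finite.of_injective f hf
  ext_eq_zero i hi :=
    ExtVanishes.left hf hfg hg (hB.ext_eq_zero i hi) (hC.ext_eq_zero _ i.succ_pos)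
  ext_dual_eq_zero
    -- Degree 1 is separate: shifting would need `Hom(C*, R) = 0`, and reflexivity of `C` takes its
    -- place.
    | 1, _ => extVanishes_dual_one hf hfg hg (hC.ext_eq_zero 1 one_pos) hC.reflexive
        (hB.ext_dual_eq_zero 1 one_pos)
    | i + 2, _ => extVanishes_dual_succ hf hfg hg (hC.ext_eq_zero 1 one_pos)
        (hC.ext_dual_eq_zero _ i.succ_pos) (hB.ext_dual_eq_zero _ (i + 1).succ_pos)
  reflexive := isReflexive_of_extVanishes hf hfg hg (hC.ext_eq_zero 1 one_pos) hB.reflexive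
    (have := hC.reflexive; (Module.bijective_dual_eval R C).1)

end

end IsTotallyReflexive

/-! ### G-dimension of syzygies -/

namespace HasGDimLE

section

variable {R : Type u} [CommRing R] {M K F : Type u}
  [AddCommGroup M] [Module R M] [AddCommGroup K] [Module R K] [AddCommGroup F] [Module R F]
  {f : K →ₗ[R] F} {g : F →ₗ[R] M}

theorem isTotallyReflexive (h : HasGDimLE R 0 M) : IsTotallyReflexive R M := by
  cases h with
  | zero _ h => exact h

theorem exists_shortExact {n : ℕ} (h : HasGDimLE R (n + 1) M) :
    ∃ (K G : Type u) (_ : AddCommGroup K) (_ : Module R K) (_ : AddCommGroup G) (_ : Module R G)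
      (f : K →ₗ[R] G) (g : G →ₗ[R] M), Function.Injective f ∧ Function.Exact f g ∧
      Function.Surjective g ∧ IsTotallyReflexive R G ∧ HasGDimLE R n K := by
  cases h with
  | succ _ K G _ f g hf hfg hg hG hK => exact ⟨K, G, _, _, _, _, f, g, hf, hfg, hg, hG, hK⟩

/-- A syzygy of a module of G-dimension at most `n + 1` has G-dimension at most `n`. -/
theorem syzygy [IsNoetherianRing R] [Module.Finite R F] [Module.Projective R F] {n : ℕ}
    (h : HasGDimLE R (n + 1) M) (hf : Function.Injective f) (hfg : Function.Exact f g) (hg : Function.Surjective g) :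
    HasGDimLE R n K := by
  obtain ⟨L, G, _, _, _, _, j, q, hj, hjq, hq, hG, hL⟩ := h.exists_shortExact
  obtain ⟨φ, hφ⟩ := Module.projective_lifting_property q g hq
  replace hφ : ∀ y, q (φ y) = g y := LinearMap.congr_fun hφ
  -- For totally reflexive `X` mapping onto `L`, the module `Y` is the kernel of `X × F → G`, hence
  -- totally reflexive. Projection to `F` sends it onto `K` with kernel `ker p`, so `K` is resolved
  -- as `L` is.
  have key : ∀ (X : Type u) [AddCommGroup X] [Module R X] (p : X →ₗ[R] L),
      Function.Surjective p → IsTotallyReflexive R X →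
      ∃ (Y : Type u) (_ : AddCommGroup Y) (_ : Module R Y) (a : LinearMap.ker p →ₗ[R] Y)
        (b : Y →ₗ[R] K), Function.Injective a ∧ Function.Exact a b ∧ Function.Surjective b ∧
        IsTotallyReflexive R Y := by
    intro X _ _ p hp hX
    let s : X × F →ₗ[R] G := (j ∘ₗ p).coprod φ
    have hs : Function.Surjective s := by
      intro y
      obtain ⟨z, hz⟩ := hg (q y)
      obtain ⟨l, hl⟩ := (hjq (y - φ z)).1 (by rw [map_sub, hφ, hz, sub_self])
      obtain ⟨x, rfl⟩ := hp l
      exact ⟨(x, z), by simp [s, hl]⟩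
    obtain ⟨b, hb⟩ := hfg.exists_lift_of_injective hf
      (LinearMap.snd R X F ∘ₗ (LinearMap.ker s).subtype) (by
        rintro ⟨⟨x, y⟩, hxy⟩
        have := congrArg q (LinearMap.mem_ker.1 hxy)
        simpa [s, hjq.apply_apply_eq_zero, hφ] using this)
    let a : LinearMap.ker p →ₗ[R] LinearMap.ker s :=
      (LinearMap.inl R X F ∘ₗ (LinearMap.ker p).subtype).codRestrict _ (by
        rintro ⟨x, hx⟩
        simp [s, LinearMap.mem_ker.1 hx])
    refine ⟨LinearMap.ker s, _, _, a, b, ?_, ?_, ?_, .ker (LinearMap.ker s).injective_subtype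
      (LinearMap.exact_subtype_ker_map s) hs (hX.prod .of_projective) hG⟩
    · intro x y hxy
      have := congrArg (fun z => z.1.1) hxy
      exact Subtype.ext this
    · rintro ⟨⟨x, y⟩, hxy⟩
      rw [← map_eq_zero_iff f hf, hb]
      constructor
      · rintro (rfl : y = 0)
        have hx : p x = 0 := (map_eq_zero_iff j hj).1 (by simpa [s] using hxy)
        exact ⟨⟨x, hx⟩, rfl⟩
      · rintro ⟨z, hz⟩
        exact (congrArg (fun z => z.1.2) hz).symm
    · intro k
      obtain ⟨l, hl⟩ := (hjq (φ (f k))).1 (by rw [hφ, hfg.apply_apply_eq_zero])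
      obtain ⟨x, rfl⟩ := hp l
      refine ⟨⟨(-x, f k), by simp [s, hl]⟩, hf ?_⟩
      rw [hb]
      rfl
  cases n with
  | zero =>
    obtain ⟨Y, _, _, a, b, ha, hab, hb, hY⟩ := key L LinearMap.id Function.surjective_id
      hL.isTotallyReflexive
    refine .zero _ (hY.congr (LinearEquiv.ofBijective b ⟨?_, hb⟩))
    rw [injective_iff_map_eq_zero]
    intro y hy
    obtain ⟨⟨x, hx⟩, rfl⟩ := (hab y).1 hy
    have : (⟨x, hx⟩ : LinearMap.ker (LinearMap.id : L →ₗ[R] L)) = 0 := Subtype.ext hx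
    rw [this, map_zero]
  | succ n =>
    obtain ⟨L', X, _, _, _, _, j', p, hj', hjp, hp, hX, hL'⟩ := hL.exists_shortExact
    obtain ⟨Y, _, _, a, b, ha, hab, hb, hY⟩ := key X p hp hX
    obtain ⟨c, hc⟩ := Function.Exact.exists_lift_of_injective
      (LinearMap.ker p).injective_subtype (LinearMap.exact_subtype_ker_map p) j'
      hjp.apply_apply_eq_zero
    have hc1 : Function.Injective c := fun x y hxy => hj' (by rw [← hc, hxy, hc])
    have hc2 : Function.Surjective c := by
      rintro ⟨x, hx⟩
      obtain ⟨y, rfl⟩ := (hjp x).1 hx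
      exact ⟨y, Subtype.ext (hc y)⟩
    refine .succ n L' Y K (a ∘ₗ c) b (ha.comp hc1) ?_ hb hY hL'
    intro y
    rw [hab y]
    exact ⟨fun ⟨z, hz⟩ => (hc2 z).imp fun w hw => by simp [hw, hz], fun ⟨w, hw⟩ => ⟨c w, hw⟩⟩

/-- A syzygy of a totally reflexive module is totally reflexive. -/
theorem syzygy_zero [IsNoetherianRing R] [Module.Finite R F] [Module.Projective R F]
    (h : HasGDimLE R 0 M) (hf : Function.Injective f) (hfg : Function.Exact f g) (hg : Function.Surjective g) :
    HasGDimLE R 0 K :=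
  .zero _ (.ker hf hfg hg .of_projective h.isTotallyReflexive)

end

end HasGDimLE

/-! ### Reduction modulo a regular element -/

theorem Submodule.eq_top_of_forall_exists_add_smul {R M : Type*} [CommRing R] [AddCommGroup M]
    [Module R M] [Module.Finite R M] {x : R} (hx : x ∈ Ideal.jacobson (⊥ : Ideal R))
    (P : Submodule R M) (h : ∀ m, ∃ p ∈ P, ∃ m', m = p + x • m') : P = ⊤ := by
  refine top_le_iff.1 (Submodule.le_of_le_smul_of_le_jacobson_bot (I := Ideal.span {x})
    Module.Finite.fg_top ((Ideal.span_singleton_le_iff_mem _).2 hx) fun m _ => ?_)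
  obtain ⟨p, hp, m', rfl⟩ := h m
  exact Submodule.add_mem_sup hp
    (Submodule.smul_mem_smul (Ideal.mem_span_singleton_self x) trivial)

/-- The map `π : N → N'` exhibits `N'` as the quotient `N / xN`, and `x` is a nonzerodivisor
on `N`. -/
structure IsReduction {R : Type*} [CommRing R] (x : R) {N N' : Type*} [AddCommGroup N] [Module R N]
    [AddCommGroup N'] [Module R N'] (π : N →ₗ[R] N') : Prop where
  regular : IsSMulRegular N x
  exact : Function.Exact (LinearMap.lsmul R N x) π
  surjective : Function.Surjective π

theorem Finsupp.isSMulRegular {R ι : Type*} [CommRing R] {x : R} (hx : IsSMulRegular R x) :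
    IsSMulRegular (ι →₀ R) x :=
  fun _ _ h => Finsupp.ext fun i => hx (DFunLike.congr_fun h i)

/-- The regularity clause makes the kernel of `g` regular as well, so that whole presentations can
be reduced modulo `x`. -/
theorem Module.exists_projective_presentation (R N : Type u) [CommRing R] [AddCommGroup N]
    [Module R N] : ∃ (F : Type u) (_ : AddCommGroup F) (_ : Module R F) (g : F →ₗ[R] N),
      Module.Projective R F ∧ Function.Surjective g ∧
      ∀ x : R, IsSMulRegular R x → IsSMulRegular F x :=
  ⟨N →₀ R, inferInstance, inferInstance, Finsupp.linearCombination R id, inferInstance,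
    Finsupp.linearCombination_id_surjective R N, fun _ hx => Finsupp.isSMulRegular hx⟩

theorem IsSMulRegular.module_dual {R N : Type*} [CommRing R] [AddCommGroup N] [Module R N] {x : R}
    (hx : IsSMulRegular R x) : IsSMulRegular (Module.Dual R N) x :=
  fun _ _ h => LinearMap.ext fun n => hx (LinearMap.congr_fun h n)

namespace IsReduction

section

variable {R : Type*} [CommRing R] {x : R} {N N' : Type*} [AddCommGroup N] [Module R N]
  [AddCommGroup N'] [Module R N'] {π : N →ₗ[R] N'}

theorem map_smul_eq_zero (h : IsReduction x π) (n : N) : π (x • n) = 0 :=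
  h.exact.apply_apply_eq_zero n

theorem exists_eq_smul (h : IsReduction x π) {n : N} (hn : π n = 0) : ∃ m, n = x • m := by
  obtain ⟨m, hm⟩ := (h.exact n).1 hn
  exact ⟨m, hm.symm⟩

theorem lsmul_injective (h : IsReduction x π) : Function.Injective (LinearMap.lsmul R N x) :=
  h.regular

end

section

variable {R S : Type u} [CommRing R] [CommRing S] [Algebra R S] {x : R}
  (hS : IsReduction x (Algebra.linearMap R S))

include hS in
theorem algebraMap_surjective :
    Function.Surjective (algebraMap R S) := hS.surjective

include hS in
theorem algebraMap_self : algebraMap R S x = 0 := by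
  simpa using hS.map_smul_eq_zero 1

variable {N N' K K' F F' W : Type u} [AddCommGroup N] [Module R N]
  [AddCommGroup N'] [Module R N'] [Module S N'] [IsScalarTower R S N']
  [AddCommGroup K] [Module R K] [AddCommGroup K'] [Module R K'] [Module S K'] [IsScalarTower R S K']
  [AddCommGroup F] [Module R F] [AddCommGroup F'] [Module R F'] [Module S F'] [IsScalarTower R S F']
  [AddCommGroup W] [Module R W] [Module S W] [IsScalarTower R S W]
  {π : N →ₗ[R] N'} {πK : K →ₗ[R] K'} {πF : F →ₗ[R] F'} {f : K →ₗ[R] F} {g : F →ₗ[R] N}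

include hS in
theorem smul_eq_zero_of_tower (w : W) : x • w = 0 := by
  rw [← algebraMap_smul S, hS.algebraMap_self, zero_smul]

include hS in
/-- Maps from `N` to a module over `R / x` factor through `N / xN`. -/
theorem exists_desc (hπ : IsReduction x π) (h : N →ₗ[R] W) :
    ∃ h' : N' →ₗ[S] W, ∀ n, h' (π n) = h n := by
  obtain ⟨l, hl⟩ := hπ.exact.exists_desc_of_surjective hπ.surjective h fun a => by
    rw [LinearMap.lsmul_apply, map_smul, hS.smul_eq_zero_of_tower]
  exact ⟨l.extendScalarsOfSurjective hS.algebraMap_surjective, hl⟩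

-- Right exactness of the tensor product, applied to `R → R → S → 0` with first map `x`.
include hS in
theorem tensor (hN : IsSMulRegular N x) : IsReduction x (TensorProduct.mk R S N 1) where
  regular := hN
  exact := by
    have h := rTensor_exact N hS.exact hS.surjective
    intro n
    have e : (Algebra.linearMap R S).rTensor N ((TensorProduct.lid R N).symm n) =
        TensorProduct.mk R S N 1 n := by simp
    rw [← e, h ((TensorProduct.lid R N).symm n)]
    constructor
    · rintro ⟨z, hz⟩
      obtain ⟨m, rfl⟩ := (TensorProduct.lid R N).symm.surjective z
      refine ⟨m, ?_⟩
      simpa [mul_smul] using congrArg (TensorProduct.lid R N) hz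
    · rintro ⟨m, rfl⟩
      exact ⟨(TensorProduct.lid R N).symm m, by simp [TensorProduct.smul_tmul']⟩
  surjective z := by
    induction z with
    | zero => exact ⟨0, map_zero _⟩
    | add a b ha hb =>
      obtain ⟨a, rfl⟩ := ha
      obtain ⟨b, rfl⟩ := hb
      exact ⟨a + b, map_add _ _ _⟩
    | tmul s n =>
      obtain ⟨r, rfl⟩ := hS.algebraMap_surjective s
      exact ⟨r • n, by rw [map_smul, TensorProduct.mk_apply, TensorProduct.smul_tmul',
        Algebra.smul_def, mul_one]⟩

include hS in
/-- Reduction modulo `x` is exact on short exact sequences of `x`-regular modules. -/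
theorem exists_shortExact (hK : IsReduction x πK) (hF : IsReduction x πF) (hN : IsReduction x π)
    (hf : Function.Injective f) (hfg : Function.Exact f g) (hg : Function.Surjective g) :
    ∃ (f' : K' →ₗ[S] F') (g' : F' →ₗ[S] N'), (∀ k, f' (πK k) = πF (f k)) ∧
      (∀ y, g' (πF y) = π (g y)) ∧ Function.Injective f' ∧ Function.Exact f' g' ∧
      Function.Surjective g' := by
  obtain ⟨f', hf'⟩ := exists_desc hS hK (πF ∘ₗ f)
  obtain ⟨g', hg'⟩ := exists_desc hS hF (π ∘ₗ g)
  simp only [LinearMap.comp_apply] at hf' hg'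
  refine ⟨f', g', hf', hg', ?_, ?_, ?_⟩
  · rw [injective_iff_map_eq_zero]
    intro k' hk'
    obtain ⟨k, rfl⟩ := hK.surjective k'
    rw [hf'] at hk'
    obtain ⟨y, hy⟩ := hF.exists_eq_smul hk'
    -- Only here is regularity of `x` on `N` used: it keeps the reduced map injective.
    have : g y = 0 := hN.regular.right_eq_zero_of_smul (by
      rw [← map_smul, ← hy, hfg.apply_apply_eq_zero])
    obtain ⟨l, rfl⟩ := (hfg y).1 this
    rw [hf (hy.trans (map_smul f x l).symm), hK.map_smul_eq_zero]
  · intro y'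
    obtain ⟨y, rfl⟩ := hF.surjective y'
    rw [hg']
    constructor
    · intro h
      obtain ⟨n, hn⟩ := hN.exists_eq_smul h
      obtain ⟨z, rfl⟩ := hg n
      obtain ⟨k, hk⟩ := (hfg (y - x • z)).1 (by rw [map_sub, hn, map_smul, sub_self])
      refine ⟨πK k, ?_⟩
      rw [hf', hk, map_sub, hF.map_smul_eq_zero, sub_zero]
    · rintro ⟨k', hk⟩
      obtain ⟨k, rfl⟩ := hK.surjective k'
      rw [hf'] at hk
      rw [← hg', ← hk, hg', hfg.apply_apply_eq_zero, map_zero]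
  · intro n'
    obtain ⟨n, rfl⟩ := hN.surjective n'
    obtain ⟨y, rfl⟩ := hg n
    exact ⟨πF y, hg' y⟩

-- A presentation of `N` by a free module reduces to an `S`-presentation of `N'`, and maps from `K`
-- or `F` to an `S`-module factor uniquely through the reductions. The extension problems defining
-- `Ext^1` therefore agree; higher degrees follow by dimension shifting.
include hS in
theorem extVanishes_iff (hπ : IsReduction x π) (i : ℕ) :
    ExtVanishes R N W (i + 1) ↔ ExtVanishes S N' W (i + 1) := by
  have hx : IsSMulRegular R x := hS.regular
  induction i generalizing N N' with
  | zero =>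
    obtain ⟨F, _, _, g, hFp, hg, hF⟩ := Module.exists_projective_presentation R N
    replace hF := hS.tensor (hF x hx)
    have hK := hS.tensor (hF.regular.of_injective (LinearMap.ker g).subtype
      (LinearMap.ker g).injective_subtype)
    obtain ⟨f', g', hf', hg', h1, h2, h3⟩ := exists_shortExact hS hK hF hπ
      (LinearMap.ker g).injective_subtype (LinearMap.exact_subtype_ker_map g) hg
    rw [ExtVanishes.one_iff h1 h2 h3, ExtVanishes.one_iff
      (LinearMap.ker g).injective_subtype
      (LinearMap.exact_subtype_ker_map g) hg]
    constructor
    · intro H h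
      obtain ⟨l, hl⟩ := H (h.restrictScalars R ∘ₗ TensorProduct.mk R S (LinearMap.ker g) 1)
      obtain ⟨l', hl'⟩ := exists_desc hS hF l
      refine ⟨l', LinearMap.ext fun k' => ?_⟩
      obtain ⟨k, rfl⟩ := hK.surjective k'
      rw [LinearMap.comp_apply, hf', hl']
      exact LinearMap.congr_fun hl k
    · intro H h
      obtain ⟨l, hl⟩ := exists_desc hS hK h
      obtain ⟨l', hl'⟩ := H l
      refine ⟨l'.restrictScalars R ∘ₗ TensorProduct.mk R S F 1, LinearMap.ext fun k => ?_⟩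
      rw [← hl, ← hl', LinearMap.comp_apply, LinearMap.comp_apply, LinearMap.comp_apply, hf']
      rfl
  | succ i ih =>
    obtain ⟨F, _, _, g, hFp, hg, hF⟩ := Module.exists_projective_presentation R N
    replace hF := hS.tensor (hF x hx)
    have hK := hS.tensor (hF.regular.of_injective (LinearMap.ker g).subtype
      (LinearMap.ker g).injective_subtype)
    obtain ⟨f', g', hf', hg', h1, h2, h3⟩ := exists_shortExact hS hK hF hπ
      (LinearMap.ker g).injective_subtype (LinearMap.exact_subtype_ker_map g) hg
    rw [ExtVanishes.shift_iff h1 h2 h3, ExtVanishes.shift_iff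
      (LinearMap.ker g).injective_subtype
      (LinearMap.exact_subtype_ker_map g) hg]
    exact ih hK

theorem extVanishes_algebra (hS : IsReduction x (Algebra.linearMap R S)) {i : ℕ}
    (h₁ : ExtVanishes R N R i) (h₂ : ExtVanishes R N R (i + 1)) : ExtVanishes R N S i :=
  ExtVanishes.cov_right hS.lsmul_injective hS.exact hS.surjective h₁ h₂

include hS in
/-- By Nakayama's lemma, vanishing of `Ext(N, R)` can be tested modulo `x`. -/
theorem extVanishes_of_algebra [IsNoetherianRing R] [Module.Finite R N]
    (hx : x ∈ Ideal.jacobson (⊥ : Ideal R)) (i : ℕ) (h : ExtVanishes R N S (i + 1)) :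
    ExtVanishes R N R (i + 1) := by
  induction i generalizing N with
  | zero =>
    obtain ⟨n, g, hg⟩ := Module.Finite.exists_fin' R N
    rw [ExtVanishes.one_iff (B := Fin n → R) (LinearMap.ker g).injective_subtype
      (LinearMap.exact_subtype_ker_map g) hg] at h ⊢
    -- Extend a functional modulo `x`, lift the extension to `R` by freeness, and divide the error
    -- by `x`: Nakayama's lemma applies.
    have : LinearMap.range (LinearMap.ker g).subtype.dualMap = ⊤ := by
      refine Submodule.eq_top_of_forall_exists_add_smul hx _ fun l => ?_
      obtain ⟨l', hl'⟩ := h (Algebra.linearMap R S ∘ₗ l)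
      obtain ⟨l₁, hl₁⟩ := Module.projective_lifting_property (Algebra.linearMap R S) l'
        hS.surjective
      obtain ⟨m, hm⟩ := Function.Exact.exists_lift_of_injective hS.lsmul_injective hS.exact
        (l - l₁ ∘ₗ (LinearMap.ker g).subtype) (fun k => by
          have h1 := LinearMap.congr_fun hl' k
          rw [← hl₁] at h1
          rw [LinearMap.sub_apply, map_sub, sub_eq_zero]
          exact h1.symm)
      refine ⟨_, ⟨l₁, rfl⟩, m, LinearMap.ext fun k => ?_⟩
      rw [LinearMap.add_apply, LinearMap.smul_apply]
      exact (sub_eq_iff_eq_add'.1 (hm k).symm)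
    exact LinearMap.range_eq_top.1 this
  | succ i ih =>
    obtain ⟨n, g, hg⟩ := Module.Finite.exists_fin' R N
    rw [ExtVanishes.shift_iff (B := Fin n → R) (LinearMap.ker g).injective_subtype
      (LinearMap.exact_subtype_ker_map g) hg] at h ⊢
    exact ih h

include hS in
/-- If `Ext^1_R(N, R) = 0`, then `Hom_S(N / xN, S)` is the reduction of `Hom_R(N, R)`. -/
theorem exists_dual (hπ : IsReduction x π) (h : ExtVanishes R N R 1) :
    ∃ δ : Module.Dual R N →ₗ[R] Module.Dual S N', IsReduction x δ ∧
      ∀ φ n, δ φ (π n) = algebraMap R S (φ n) := by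
  choose δ hδ using fun φ : Module.Dual R N => exists_desc hS hπ (Algebra.linearMap R S ∘ₗ φ)
  simp only [LinearMap.comp_apply, Algebra.linearMap_apply] at hδ
  refine ⟨⟨⟨δ, fun φ ψ => ?_⟩, fun r φ => ?_⟩, ⟨?_, ?_, ?_⟩, hδ⟩
  · ext n'
    obtain ⟨n, rfl⟩ := hπ.surjective n'
    simp [hδ]
  · ext n'
    obtain ⟨n, rfl⟩ := hπ.surjective n'
    simp [hδ, Algebra.smul_def]
  · exact IsSMulRegular.module_dual hS.regular
  · intro φ
    constructor
    · intro hφ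
      obtain ⟨ψ, hψ⟩ := Function.Exact.exists_lift_of_injective hS.lsmul_injective hS.exact φ
        (fun n => by rw [Algebra.linearMap_apply, ← hδ]; exact LinearMap.congr_fun hφ (π n))
      exact ⟨ψ, LinearMap.ext hψ⟩
    · rintro ⟨ψ, rfl⟩
      ext n'
      obtain ⟨n, rfl⟩ := hπ.surjective n'
      simp [hδ, hS.smul_eq_zero_of_tower]
  · intro φ'
    -- Surjectivity is where `Ext^1(N, R) = 0` enters: functionals with values in `S` lift to `R`.
    obtain ⟨φ, hφ⟩ := ExtVanishes.exists_lift hS.lsmul_injective hS.exact hS.surjective h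
      (φ'.restrictScalars R ∘ₗ π)
    refine ⟨φ, LinearMap.ext fun n' => ?_⟩
    obtain ⟨n, rfl⟩ := hπ.surjective n'
    exact (hδ φ n).trans (LinearMap.congr_fun hφ n)

include hS in
/-- The bidual of `N / xN` is the reduction of the bidual of `N`, compatibly with evaluation. -/
theorem exists_bidual (hπ : IsReduction x π) (h : ExtVanishes R N R 1)
    (h' : ExtVanishes R (Module.Dual R N) R 1) :
    ∃ ε : Module.Dual R (Module.Dual R N) →ₗ[R] Module.Dual S (Module.Dual S N'),
      IsReduction x ε ∧ ∀ n, ε (Module.Dual.eval R N n) = Module.Dual.eval S N' (π n) := by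
  obtain ⟨δ, hδ, hδ'⟩ := hS.exists_dual hπ h
  obtain ⟨ε, hε, hε'⟩ := hS.exists_dual hδ h'
  refine ⟨ε, hε, fun n => LinearMap.ext fun φ' => ?_⟩
  obtain ⟨φ, rfl⟩ := hδ.surjective φ'
  rw [hε', Module.Dual.eval_apply, Module.Dual.eval_apply, hδ']

include hS in
theorem isTotallyReflexive (hπ : IsReduction x π) (h : IsTotallyReflexive R N) :
    IsTotallyReflexive S N' := by
  have hN := h.ext_eq_zero 1 one_pos
  have hN' := h.ext_dual_eq_zero 1 one_pos
  obtain ⟨δ, hδ, -⟩ := hS.exists_dual hπ hN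
  obtain ⟨ε, hε, hε'⟩ := hS.exists_bidual hπ hN hN'
  have := h.finite
  have := h.reflexive
  have : Module.Finite R N' := Module.Finite.of_surjective π hπ.surjective
  refine ⟨.of_restrictScalars_finite R S N', ?_, ?_, ⟨?_, ?_⟩⟩
  · rintro (_ | i) hi
    · exact absurd hi (lt_irrefl _)
    · exact (extVanishes_iff hS hπ i).1
        (hS.extVanishes_algebra (h.ext_eq_zero _ hi) (h.ext_eq_zero _ (Nat.succ_pos _)))
  · rintro (_ | i) hi
    · exact absurd hi (lt_irrefl _)
    · exact (extVanishes_iff hS hδ i).1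
        (hS.extVanishes_algebra (h.ext_dual_eq_zero _ hi) (h.ext_dual_eq_zero _ (Nat.succ_pos _)))
  · rw [injective_iff_map_eq_zero]
    intro n' hn'
    obtain ⟨n, rfl⟩ := hπ.surjective n'
    rw [← hε'] at hn'
    obtain ⟨ξ, hξ⟩ := hε.exists_eq_smul hn'
    obtain ⟨m, rfl⟩ := (Module.bijective_dual_eval R N).2 ξ
    rw [← map_smul] at hξ
    rw [(Module.bijective_dual_eval R N).1 hξ, hπ.map_smul_eq_zero]
  · intro ξ'
    obtain ⟨ξ, rfl⟩ := hε.surjective ξ'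
    obtain ⟨n, rfl⟩ := (Module.bijective_dual_eval R N).2 ξ
    exact ⟨π n, (hε' n).symm⟩

-- Ext vanishing lifts from `S` by Nakayama's lemma, which makes duals and biduals commute with
-- reduction. Nakayama's lemma then applies to the kernel and to the image of the biduality map.
include hS in
theorem isTotallyReflexive_of_reduction [IsNoetherianRing R] [Module.Finite R N]
    (hx : x ∈ Ideal.jacobson (⊥ : Ideal R)) (hπ : IsReduction x π) (h : IsTotallyReflexive S N') :
    IsTotallyReflexive R N := by
  have key : ∀ i, 0 < i → ExtVanishes R N R i := by
    rintro (_ | i) hi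
    · exact absurd hi (lt_irrefl _)
    · exact hS.extVanishes_of_algebra hx i ((extVanishes_iff hS hπ i).2 (h.ext_eq_zero _ hi))
  obtain ⟨δ, hδ, -⟩ := hS.exists_dual hπ (key 1 one_pos)
  have key' : ∀ i, 0 < i → ExtVanishes R (Module.Dual R N) R i := by
    rintro (_ | i) hi
    · exact absurd hi (lt_irrefl _)
    · exact hS.extVanishes_of_algebra hx i ((extVanishes_iff hS hδ i).2 (h.ext_dual_eq_zero _ hi))
  obtain ⟨ε, hε, hε'⟩ := hS.exists_bidual hπ (key 1 one_pos) (key' 1 one_pos)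
  have := h.reflexive
  refine ⟨inferInstance, key, key', ⟨?_, ?_⟩⟩
  · have hker : (⊥ : Submodule R (LinearMap.ker (Module.Dual.eval R N))) = ⊤ := by
      refine Submodule.eq_top_of_forall_exists_add_smul hx _ fun ⟨n, hn⟩ => ⟨0, rfl, ?_⟩
      rw [LinearMap.mem_ker] at hn
      have h1 : π n = 0 := (Module.bijective_dual_eval S N').1 (by
        rw [← hε', hn, map_zero, map_zero])
      obtain ⟨m, rfl⟩ := hπ.exists_eq_smul h1
      -- Since `x` is regular on the bidual, `m` lies in the kernel again, so the kernel equals `x`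
      -- times itself.
      refine ⟨⟨m, hε.regular.right_eq_zero_of_smul (by rw [← map_smul, hn])⟩, Subtype.ext ?_⟩
      simp
    rw [← LinearMap.ker_eq_bot, ← Submodule.subsingleton_iff_eq_bot]
    exact (Submodule.subsingleton_iff R).1 (subsingleton_of_bot_eq_top hker)
  · rw [← LinearMap.range_eq_top]
    refine Submodule.eq_top_of_forall_exists_add_smul hx _ fun ξ => ?_
    obtain ⟨n', hn'⟩ := (Module.bijective_dual_eval S N').2 (ε ξ)
    obtain ⟨n, rfl⟩ := hπ.surjective n'
    obtain ⟨m, hm⟩ := hε.exists_eq_smul (n := ξ - Module.Dual.eval R N n)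
      (by rw [map_sub, hε', hn', sub_self])
    exact ⟨_, ⟨n, rfl⟩, m, sub_eq_iff_eq_add'.1 hm⟩

end

end IsReduction

/-! ### Property (TG) through Ext and character modules -/

theorem propertyTG_iff (R : Type u) [CommRing R] : PropertyTG R ↔
    ∀ (M : Type u) [AddCommGroup M] [Module R M], Module.Finite R M →
      (∃ n : ℕ, ∀ i : ℕ, n ≤ i → ExtVanishes R M (CharacterModule M) (i + 1)) →
      HasFiniteGDim R M := by
  refine forall_congr' fun M => forall_congr' fun _ => forall_congr' fun _ => forall_congr' fun _ =>
    imp_congr_left ⟨fun ⟨n, hn⟩ => ⟨n, fun i hi => ?_⟩, fun ⟨n, hn⟩ => ⟨n + 1, fun i hi => ?_⟩⟩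
  · exact (isZero_tor_succ_iff M M i).1 (hn _ (by omega))
  · obtain ⟨i, rfl⟩ : ∃ j, i = j + 1 := ⟨i - 1, by omega⟩
    exact (isZero_tor_succ_iff M M i).2 (hn _ (by omega))

namespace CharacterModule

variable {R A B C : Type*} [CommRing R] [AddCommGroup A] [Module R A] [AddCommGroup B] [Module R B]
  [AddCommGroup C] [Module R C] {f : A →ₗ[R] B} {g : B →ₗ[R] C}

theorem dual_exact (hfg : Function.Exact f g) (hg : Function.Surjective g) :
    Function.Exact (dual g) (dual f) := by
  intro φ
  constructor
  · intro h
    have h' : ∀ a, φ (f a) = 0 := fun a => DFunLike.congr_fun h a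
    have hk : ∀ b b', g b = g b' → φ b = φ b' := fun b b' hb => by
      obtain ⟨a, ha⟩ := (hfg (b - b')).1 (by rw [map_sub, hb, sub_self])
      rw [← sub_eq_zero, ← map_sub, ← ha, h']
    choose s hs using hg
    refine ⟨(⟨⟨fun c => φ (s c), (hk _ 0 (by rw [hs, map_zero])).trans (map_zero φ)⟩,
      fun c d => (hk _ _ (by simp [hs])).trans (map_add φ _ _)⟩ : C →+ AddCircle (1 : ℚ)), ?_⟩
    ext b
    exact hk _ _ (hs _)
  · rintro ⟨ψ, rfl⟩
    ext a
    exact (congrArg ψ (hfg.apply_apply_eq_zero a)).trans (map_zero ψ)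

instance isScalarTower {R S M : Type*} [CommRing R] [CommRing S] [Algebra R S] [AddCommGroup M]
    [Module R M] [Module S M] [IsScalarTower R S M] : IsScalarTower R S (CharacterModule M) :=
  ⟨fun r s c => by
    ext m
    change c ((r • s) • m) = c (s • r • m)
    rw [smul_comm, smul_assoc]⟩

end CharacterModule

/-- `Ext(X, N^∨)` for a syzygy `N` of `M`. -/
theorem ExtVanishes.characterModule_syzygy {R : Type u} [CommRing R] {N F M X : Type u}
    [AddCommGroup N] [Module R N] [AddCommGroup F] [Module R F] [Module.Projective R F]
    [AddCommGroup M] [Module R M] [AddCommGroup X] [Module R X] {f : N →ₗ[R] F} {g : F →ₗ[R] M}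
    (hf : Function.Injective f) (hfg : Function.Exact f g) (hg : Function.Surjective g) {i : ℕ}
    (h : ExtVanishes R X (CharacterModule M) (i + 2)) :
    ExtVanishes R X (CharacterModule N) (i + 1) := by
  -- `F` is flat, so its character module is injective and the index shifts by one.
  have : Module.Injective R (CharacterModule F) :=
    Module.Flat.iff_characterModule_injective.1 inferInstance
  exact ExtVanishes.cov_right (CharacterModule.dual_injective_of_surjective g hg)
    (CharacterModule.dual_exact hfg hg) (CharacterModule.dual_surjective_of_injective f hf)
    (of_injective i) h

/-- Dualizing `0 → N → N → N' → 0` gives `0 → N'^∨ → N^∨ → N^∨ → 0`; use its long exact sequence. -/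
theorem ExtVanishes.characterModule_reduction {R : Type u} [CommRing R] {x : R} {N N' X : Type u}
    [AddCommGroup N] [Module R N] [AddCommGroup N'] [Module R N'] [AddCommGroup X] [Module R X]
    {π : N →ₗ[R] N'} (hπ : IsReduction x π) {i : ℕ}
    (h : ExtVanishes R X (CharacterModule N) i) (h' : ExtVanishes R X (CharacterModule N) (i + 1)) :
    ExtVanishes R X (CharacterModule N') (i + 1) :=
  ExtVanishes.cov_left (CharacterModule.dual_injective_of_surjective π hπ.surjective)
    (CharacterModule.dual_exact hπ.exact hπ.surjective)
    (CharacterModule.dual_surjective_of_injective _ hπ.lsmul_injective) h h'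

theorem Module.Finite.exists_projective_presentation (R N : Type u) [CommRing R] [AddCommGroup N]
    [Module R N] [Module.Finite R N] :
    ∃ (F : Type u) (_ : AddCommGroup F) (_ : Module R F) (g : F →ₗ[R] N),
      Module.Finite R F ∧ Module.Projective R F ∧ Function.Surjective g ∧
      ∀ x : R, IsSMulRegular R x → IsSMulRegular F x := by
  obtain ⟨n, g, hg⟩ := Module.Finite.exists_fin' R N
  exact ⟨Fin n → R, _, _, g, inferInstance, inferInstance, hg,
    fun x hx a b h => funext fun i => hx (congrFun h i)⟩

/-! ### Passing (TG) from `R/x` to `R` -/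

namespace IsReduction

section

variable {R S : Type u} [CommRing R] [CommRing S] [Algebra R S] {x : R} [IsNoetherianRing R]
  (hS : IsReduction x (Algebra.linearMap R S))

-- Reducing a presentation of `N` gives one of `N'`, so syzygies correspond and the claim descends
-- to total reflexivity.
include hS in
theorem hasGDimLE_of_reduction (hx : x ∈ Ideal.jacobson (⊥ : Ideal R)) (m : ℕ) {N N' : Type u}
    [AddCommGroup N] [Module R N] [Module.Finite R N] [AddCommGroup N'] [Module R N'] [Module S N']
    [IsScalarTower R S N'] {π : N →ₗ[R] N'} (hπ : IsReduction x π) (h : HasGDimLE S m N') :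
    HasGDimLE R m N := by
  have : IsNoetherianRing S := isNoetherianRing_of_surjective R S _ hS.algebraMap_surjective
  induction m generalizing N N' with
  | zero => exact .zero _ (hS.isTotallyReflexive_of_reduction hx hπ h.isTotallyReflexive)
  | succ m ih =>
    obtain ⟨F, _, _, g, _, _, hg, hF⟩ := Module.Finite.exists_projective_presentation R N
    replace hF := hS.tensor (hF x hS.regular)
    have hK := hS.tensor (hF.regular.of_injective (LinearMap.ker g).subtype
      (LinearMap.ker g).injective_subtype)
    obtain ⟨f', g', hf', hg', h1, h2, h3⟩ := exists_shortExact hS hK hF hπ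
      (LinearMap.ker g).injective_subtype (LinearMap.exact_subtype_ker_map g) hg
    exact .succ m _ F N _ g (LinearMap.ker g).injective_subtype (LinearMap.exact_subtype_ker_map g)
      hg .of_projective (ih hK (h.syzygy h1 h2 h3))

include hS in
theorem propertyTG_of_reduction (hx : x ∈ Ideal.jacobson (⊥ : Ideal R)) (h : PropertyTG S) :
    PropertyTG R := by
  rw [propertyTG_iff] at h ⊢
  intro M _ _ _ ⟨n, hn⟩
  obtain ⟨F, _, _, g, _, _, hg, hF⟩ := Module.Finite.exists_projective_presentation R M
  have hf := (LinearMap.ker g).injective_subtype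
  have hfg := LinearMap.exact_subtype_ker_map g
  have hN := hS.tensor ((hF x hS.regular).of_injective (LinearMap.ker g).subtype hf)
  have h1 : ∀ i, n ≤ i →
      ExtVanishes R (LinearMap.ker g) (CharacterModule (LinearMap.ker g)) (i + 1) :=
    fun i hi => .characterModule_syzygy hf hfg hg
      ((ExtVanishes.shift_iff hf hfg hg (i + 1)).1 (hn (i + 2) (by omega)))
  obtain ⟨m, hm⟩ := h (S ⊗[R] LinearMap.ker g) inferInstance ⟨n + 1, fun i hi => by
    obtain ⟨i, rfl⟩ : ∃ j, i = j + 1 := ⟨i - 1, by omega⟩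
    exact (extVanishes_iff hS hN _).1 (.characterModule_reduction hN (h1 i (by omega))
      (h1 (i + 1) (by omega)))⟩
  exact ⟨m + 1, .succ m _ F M _ g hf hfg hg .of_projective
    (hasGDimLE_of_reduction hS hx m hN hm)⟩

end

end IsReduction

/-! ### Passing (TG) from `R` to `R/x` -/

namespace IsReduction

section

variable {R S : Type u} [CommRing R] [CommRing S] [Algebra R S] {x : R}
  (hS : IsReduction x (Algebra.linearMap R S))
  {M K K' F F' : Type u} [AddCommGroup M] [Module R M] [Module S M] [IsScalarTower R S M]
  [AddCommGroup K] [Module R K] [AddCommGroup K'] [Module R K'] [Module S K'] [IsScalarTower R S K']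
  [AddCommGroup F] [Module R F] [AddCommGroup F'] [Module R F'] [Module S F'] [IsScalarTower R S F']
  {πK : K →ₗ[R] K'} {πF : F →ₗ[R] F'} {f : K →ₗ[R] F} {g : F →ₗ[R] M}

include hS in
/-- Multiplication by `x` on `F` factors through a syzygy `K` of an `R / x`-module. -/
theorem exists_mulMap (hf : Function.Injective f) (hfg : Function.Exact f g) :
    ∃ μ : F →ₗ[R] K, (∀ y, f (μ y) = x • y) ∧ ∀ k, μ (f k) = x • k := by
  obtain ⟨μ, hμ⟩ := hfg.exists_lift_of_injective hf (LinearMap.lsmul R F x)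
    (fun y => by rw [LinearMap.lsmul_apply, map_smul, hS.smul_eq_zero_of_tower])
  exact ⟨μ, hμ, fun k => hf (by rw [hμ, map_smul, LinearMap.lsmul_apply])⟩

include hS in
/-- For an `R / x`-module `M` with `R`-presentation `0 → K → F → M → 0`, the exact sequence
`0 → M → K / xK → F / xF → M → 0`. -/
theorem exists_four_term (hK : IsReduction x πK) (hF : IsReduction x πF)
    (hf : Function.Injective f) (hfg : Function.Exact f g) (hg : Function.Surjective g) :
    ∃ (L₁ : Type u) (_ : AddCommGroup L₁) (_ : Module R L₁) (_ : Module S L₁)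
      (_ : IsScalarTower R S L₁) (a : M →ₗ[S] K') (b : K' →ₗ[S] L₁) (c : L₁ →ₗ[S] F')
      (d : F' →ₗ[S] M), (∀ k, c (b (πK k)) = πF (f k)) ∧
      Function.Injective a ∧ Function.Exact a b ∧ Function.Surjective b ∧
      Function.Injective c ∧ Function.Exact c d ∧ Function.Surjective d := by
  obtain ⟨g', hg'⟩ := exists_desc hS hF g
  obtain ⟨μ, hμ, hμ'⟩ := exists_mulMap hS hf hfg
  -- The connecting map `M → K/xK` sends the class of `y` to the class of `x • y`, an element of
  -- `K`.
  obtain ⟨a, ha⟩ := hfg.exists_desc_of_surjective hg (πK ∘ₗ μ) fun k => by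
    rw [LinearMap.comp_apply, hμ', hK.map_smul_eq_zero]
  obtain ⟨b₀, hb₀⟩ := exists_desc hS hK (πF ∘ₗ f)
  let b : K' →ₗ[S] LinearMap.ker g' := b₀.codRestrict _ fun k' => by
    obtain ⟨k, rfl⟩ := hK.surjective k'
    rw [LinearMap.mem_ker, hb₀, LinearMap.comp_apply, hg', hfg.apply_apply_eq_zero]
  have hb : ∀ k, (b (πK k) : F') = πF (f k) := hb₀
  refine ⟨LinearMap.ker g', _, _, _, inferInstance,
    a.extendScalarsOfSurjective hS.algebraMap_surjective, b, (LinearMap.ker g').subtype, g', hb,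
    ?_, ?_, ?_, (LinearMap.ker g').injective_subtype, LinearMap.exact_subtype_ker_map g',
    fun m => ?_⟩
  · rw [injective_iff_map_eq_zero]
    intro m hm
    obtain ⟨y, rfl⟩ := hg m
    obtain ⟨k, hk⟩ := hK.exists_eq_smul ((ha y).symm.trans hm)
    have : y = f k := hF.regular (by
      change x • y = x • f k
      rw [← hμ, hk, map_smul])
    rw [this, hfg.apply_apply_eq_zero]
  · intro k'
    obtain ⟨k, rfl⟩ := hK.surjective k'
    rw [← Subtype.coe_inj, hb]
    constructor
    · intro h
      obtain ⟨y, hy⟩ := hF.exists_eq_smul h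
      refine ⟨g y, (ha y).trans ?_⟩
      rw [LinearMap.comp_apply, hf (hy.trans (hμ y).symm)]
    · rintro ⟨m, hm⟩
      obtain ⟨y, rfl⟩ := hg m
      have h1 : πK (μ y) = πK k := (ha y).symm.trans hm
      rw [← hb, ← h1, hb, hμ, hF.map_smul_eq_zero]
      rfl
  · rintro ⟨z, hz⟩
    obtain ⟨y, rfl⟩ := hF.surjective z
    rw [LinearMap.mem_ker, hg'] at hz
    obtain ⟨k, rfl⟩ := (hfg y).1 hz
    exact ⟨πK k, Subtype.ext (hb k)⟩
  · obtain ⟨y, rfl⟩ := hg m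
    exact ⟨πF y, hg' y⟩

end

end IsReduction

/-- `M` has a first syzygy, with respect to an `x`-regular finite projective module, of G-dimension
at most `m`. -/
def SyzygyGDimLE (R : Type u) [CommRing R] (x : R) (m : ℕ) (M : Type u) [AddCommGroup M]
    [Module R M] : Prop :=
  ∃ (K F : Type u) (_ : AddCommGroup K) (_ : Module R K) (_ : AddCommGroup F) (_ : Module R F)
    (f : K →ₗ[R] F) (g : F →ₗ[R] M), Module.Finite R F ∧ Module.Projective R F ∧
    IsSMulRegular F x ∧ Function.Injective f ∧ Function.Exact f g ∧ Function.Surjective g ∧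
    HasGDimLE R m K

namespace SyzygyGDimLE

section

variable {R S : Type u} [CommRing R] [IsNoetherianRing R] [CommRing S] [Algebra R S] {x : R}
  (hS : IsReduction x (Algebra.linearMap R S))
  {L : Type u} [AddCommGroup L] [Module R L] [Module S L] [IsScalarTower R S L]

include hS

/-- `G` is `K/xK` and `L₁` is the `S`-syzygy of `L`. With truncated subtraction the case `m = 0`
reproduces itself, which drives the inductions below. -/
theorem exists_syzygy {m : ℕ} (h : SyzygyGDimLE R x m L) :
    ∃ (G F' L₁ : Type u) (_ : AddCommGroup G) (_ : Module S G) (_ : AddCommGroup F')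
      (_ : Module S F') (_ : AddCommGroup L₁) (_ : Module R L₁) (_ : Module S L₁)
      (_ : IsScalarTower R S L₁) (a : L →ₗ[S] G) (b : G →ₗ[S] L₁) (c : L₁ →ₗ[S] F')
      (d : F' →ₗ[S] L), Module.Finite S F' ∧ Module.Projective S F' ∧
      Function.Injective a ∧ Function.Exact a b ∧ Function.Surjective b ∧
      Function.Injective c ∧ Function.Exact c d ∧ Function.Surjective d ∧
      SyzygyGDimLE R x (m - 1) L₁ ∧
      (m = 0 → IsTotallyReflexive S G ∧ ExtVanishes S L S 1) := by
  obtain ⟨K, F, _, _, _, _, f, g, _, _, hFx, hf, hfg, hg, hK⟩ := h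
  have hF := hS.tensor hFx
  have hKx := hS.tensor (hFx.of_injective f hf)
  obtain ⟨L₁, _, _, _, _, a, b, c, d, hb, ha, hab, hb', hc, hcd, hd⟩ :=
    hS.exists_four_term hKx hF hf hfg hg
  obtain ⟨μ, hμ, hμ'⟩ := hS.exists_mulMap hf hfg
  have hμi : Function.Injective μ := fun y z hyz =>
    hFx (by change x • y = x • z; rw [← hμ, hyz, hμ])
  let κ : K →ₗ[R] L₁ := b.restrictScalars R ∘ₗ TensorProduct.mk R S K 1
  have hκ : ∀ k, c (κ k) = 1 ⊗ₜ f k := hb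
  have hκs : Function.Surjective κ := hb'.comp hKx.surjective
  have hμκ : Function.Exact μ κ := by
    intro k
    rw [← map_eq_zero_iff c hc, hκ]
    constructor
    · intro h
      obtain ⟨y, hy⟩ := hF.exists_eq_smul (n := f k) h
      exact ⟨y, hf ((hμ y).trans hy.symm)⟩
    · rintro ⟨y, rfl⟩
      rw [hμ]
      exact hF.map_smul_eq_zero y
  refine ⟨S ⊗[R] K, S ⊗[R] F, L₁, _, _, _, _, _, _, _, inferInstance, a, b, c, d, inferInstance,
    inferInstance, ha, hab, hb', hc, hcd, hd, ?_, ?_⟩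
  · have : Module.Finite R K := Module.Finite.of_injective f hf
    have : Module.Finite R L₁ := Module.Finite.of_surjective κ hκs
    obtain ⟨F₁, _, _, g₁, _, _, hg₁, hF₁⟩ :=
      Module.Finite.exists_projective_presentation R L₁
    obtain ⟨p, hp⟩ := Module.projective_lifting_property κ g₁ hκs
    replace hp : ∀ z, κ (p z) = g₁ z := LinearMap.congr_fun hp
    obtain ⟨l, hl⟩ := hμκ.exists_lift_of_injective hμi (-(p ∘ₗ (LinearMap.ker g₁).subtype))
      (fun z => by
        rw [LinearMap.neg_apply, map_neg, neg_eq_zero]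
        exact (hp z).trans z.2)
    have hl' : ∀ z : LinearMap.ker g₁, μ (l z) = - p z := hl
    -- From `0 → F → K → L₁ → 0` with first map `μ`, the `R`-syzygy `ker g₁` of `L₁` is also a
    -- syzygy of `K`, so its G-dimension bound drops by one.
    let s : F₁ × F →ₗ[R] K := p.coprod μ
    let j : LinearMap.ker g₁ →ₗ[R] F₁ × F := (LinearMap.ker g₁).subtype.prod l
    have hj : Function.Injective j := fun z w hzw => Subtype.ext (congrArg Prod.fst hzw)
    have hjs : Function.Exact j s := by
      rintro ⟨z, y⟩
      constructor
      · intro h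
        have h' : p z + μ y = 0 := h
        have hz : g₁ z = 0 := by
          rw [← hp, eq_neg_of_add_eq_zero_left h', map_neg, hμκ.apply_apply_eq_zero, neg_zero]
        refine ⟨⟨z, hz⟩, Prod.ext rfl (hμi ?_)⟩
        exact (hl' ⟨z, hz⟩).trans (neg_eq_of_add_eq_zero_right h')
      · rintro ⟨w, hw⟩
        rw [← hw]
        change p w + μ (l w) = 0
        rw [hl', add_neg_cancel]
    have hs : Function.Surjective s := by
      intro k
      obtain ⟨z, hz⟩ := hg₁ (κ k)
      obtain ⟨y, hy⟩ := (hμκ (k - p z)).1 (by rw [map_sub, hp, hz, sub_self])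
      refine ⟨(z, y), ?_⟩
      change p z + μ y = k
      rw [hy, add_sub_cancel]
    refine ⟨LinearMap.ker g₁, F₁, _, _, _, _, (LinearMap.ker g₁).subtype, g₁, inferInstance,
      inferInstance, hF₁ x hS.regular, (LinearMap.ker g₁).injective_subtype,
      LinearMap.exact_subtype_ker_map g₁, hg₁, ?_⟩
    cases m with
    | zero => exact hK.syzygy_zero hj hjs hs
    | succ m => exact hK.syzygy hj hjs hs
  · rintro rfl
    refine ⟨hS.isTotallyReflexive hKx hK.isTotallyReflexive, ?_⟩
    rw [ExtVanishes.one_iff hc hcd hd]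
    -- To extend `h : L₁ → S` to `F'`: lift `h ∘ κ` to `h₂ : K → R`. Then `h₂ ∘ μ` vanishes modulo
    -- `x`, so it is `x • h₃`, where `h₃` extends `h₂` to `F`; reduce `h₃`.
    intro h
    obtain ⟨h₂, hh₂⟩ := ExtVanishes.exists_lift hS.lsmul_injective hS.exact hS.surjective
      (hK.isTotallyReflexive.ext_eq_zero 1 one_pos) (h.restrictScalars R ∘ₗ κ)
    replace hh₂ : ∀ k, algebraMap R S (h₂ k) = h (κ k) := LinearMap.congr_fun hh₂
    obtain ⟨h₃, hh₃⟩ := Function.Exact.exists_lift_of_injective hS.lsmul_injective hS.exact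
      (h₂ ∘ₗ μ) (fun y => by
        rw [Algebra.linearMap_apply, LinearMap.comp_apply, hh₂, hμκ.apply_apply_eq_zero, map_zero])
    have h₃f : ∀ k, h₃ (f k) = h₂ k := fun k => hS.lsmul_injective (by
      rw [hh₃, LinearMap.comp_apply, hμ', map_smul, LinearMap.lsmul_apply])
    obtain ⟨h₄, hh₄⟩ := IsReduction.exists_desc hS hF (Algebra.linearMap R S ∘ₗ h₃)
    refine ⟨h₄, LinearMap.ext fun z => ?_⟩
    obtain ⟨k, rfl⟩ := hκs z
    rw [← hh₂, ← h₃f, LinearMap.comp_apply, hκ]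
    exact hh₄ (f k)

theorem extVanishes (h : SyzygyGDimLE R x 0 L) (i : ℕ) : ExtVanishes S L S (i + 1) := by
  induction i generalizing L with
  | zero =>
    obtain ⟨G, F', L₁, _, _, _, _, _, _, _, _, a, b, c, d, -, -, -, -, -, -, -, -, -, h'⟩ :=
      h.exists_syzygy hS
    exact (h' rfl).2
  | succ i ih =>
    obtain ⟨G, F', L₁, _, _, _, _, _, _, _, _, a, b, c, d, -, _, -, -, -, hc, hcd, hd, hL, -⟩ :=
      h.exists_syzygy hS
    exact (ExtVanishes.shift_iff hc hcd hd i).2 (ih hL)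

theorem dual_eval_injective (h : SyzygyGDimLE R x 0 L) :
    Function.Injective (Module.Dual.eval S L) := by
  obtain ⟨G, F', L₁, _, _, _, _, _, _, _, _, a, b, c, d, -, -, ha, -, -, -, -, -, -, h'⟩ :=
    h.exists_syzygy hS
  have := (h' rfl).1.reflexive
  exact dual_eval_injective_of_injective ha (Module.bijective_dual_eval S G).1

/-- In `0 → L → G → L₁ → 0`, `G` is totally reflexive and `L₁`, being of the same kind as `L`, is
torsionless with vanishing `Ext^1`. -/
theorem isReflexive (h : SyzygyGDimLE R x 0 L) : Module.IsReflexive S L := by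
  obtain ⟨G, F', L₁, _, _, _, _, _, _, _, _, a, b, c, d, -, -, ha, hab, hb, -, -, -, hL, h'⟩ :=
    h.exists_syzygy hS
  exact isReflexive_of_extVanishes ha hab hb (hL.extVanishes hS 0) (h' rfl).1.reflexive
    (hL.dual_eval_injective hS)

theorem extVanishes_dual (h : SyzygyGDimLE R x 0 L) (i : ℕ) :
    ExtVanishes S (Module.Dual S L) S (i + 1) := by
  induction i generalizing L with
  | zero =>
    obtain ⟨G, F', L₁, _, _, _, _, _, _, _, _, a, b, c, d, -, -, ha, hab, hb, -, -, -, hL, h'⟩ :=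
      h.exists_syzygy hS
    exact extVanishes_dual_one ha hab hb (hL.extVanishes hS 0) (hL.isReflexive hS)
      ((h' rfl).1.ext_dual_eq_zero 1 one_pos)
  | succ i ih =>
    obtain ⟨G, F', L₁, _, _, _, _, _, _, _, _, a, b, c, d, -, -, ha, hab, hb, -, -, -, hL, h'⟩ :=
      h.exists_syzygy hS
    exact extVanishes_dual_succ ha hab hb (hL.extVanishes hS 0) (ih hL)
      ((h' rfl).1.ext_dual_eq_zero _ (Nat.succ_pos _))

theorem isTotallyReflexive (h : SyzygyGDimLE R x 0 L) : IsTotallyReflexive S L where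
  finite := by
    obtain ⟨G, F', L₁, _, _, _, _, _, _, _, _, a, b, c, d, _, -, -, -, -, -, -, hd, -, -⟩ :=
      h.exists_syzygy hS
    exact Module.Finite.of_surjective d hd
  ext_eq_zero
    | i + 1, _ => h.extVanishes hS i
  ext_dual_eq_zero
    | i + 1, _ => h.extVanishes_dual hS i
  reflexive := h.isReflexive hS

theorem hasFiniteGDim {m : ℕ} (h : SyzygyGDimLE R x m L) : HasFiniteGDim S L := by
  induction m generalizing L with
  | zero => exact ⟨0, .zero _ (h.isTotallyReflexive hS)⟩
  | succ m ih =>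
    obtain ⟨G, F', L₁, _, _, _, _, _, _, _, _, a, b, c, d, _, _, -, -, -, hc, hcd, hd, hL, -⟩ :=
      h.exists_syzygy hS
    obtain ⟨n, hn⟩ := ih hL
    exact ⟨n + 1, .succ n L₁ F' L c d hc hcd hd .of_projective hn⟩

end

end SyzygyGDimLE

theorem IsReduction.propertyTG {R S : Type u} [CommRing R] [CommRing S] [Algebra R S] {x : R}
    [IsNoetherianRing R] (hS : IsReduction x (Algebra.linearMap R S)) (h : PropertyTG R) :
    PropertyTG S := by
  rw [propertyTG_iff] at h ⊢
  intro M _ _ _ ⟨n, hn⟩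
  let : Module R M := Module.compHom M (algebraMap R S)
  have : IsScalarTower R S M := ⟨fun r s m => by
    rw [Algebra.smul_def, mul_smul]
    rfl⟩
  have : Module.Finite R S := Module.Finite.of_surjective _ hS.surjective
  have : Module.Finite R M := Module.Finite.trans S M
  obtain ⟨F, _, _, g, _, _, hg, hFx⟩ := Module.Finite.exists_projective_presentation R M
  replace hFx := hFx x hS.regular
  have hf := (LinearMap.ker g).injective_subtype
  have hfg := LinearMap.exact_subtype_ker_map g
  have hF := hS.tensor hFx
  have hK := hS.tensor (hFx.of_injective (LinearMap.ker g).subtype hf)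
  obtain ⟨L₁, _, _, _, _, a, b, c, d, hb, ha, hab, hb', hc, hcd, hd⟩ :=
    hS.exists_four_term hK hF hf hfg hg
  obtain ⟨m, hm⟩ := h M inferInstance ⟨n + 1, fun i hi => by
    obtain ⟨i, rfl⟩ : ∃ j, i = j + 1 := ⟨i - 1, by omega⟩
    rw [ExtVanishes.shift_iff hf hfg hg]
    refine (IsReduction.extVanishes_iff hS hK i).2 ?_
    -- `K/xK` lies between `M` and its `S`-syzygy `L₁`.
    refine ExtVanishes.middle ha hab hb' (hn i (by omega)) ?_
    exact (ExtVanishes.shift_iff hc hcd hd i).1 (hn (i + 1) (by omega))⟩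
  refine SyzygyGDimLE.hasFiniteGDim hS (x := x) (m := m - 1) ⟨LinearMap.ker g, F, _, _, _, _,
    (LinearMap.ker g).subtype, g, inferInstance, inferInstance, hFx, hf, hfg, hg, ?_⟩
  cases m with
  | zero => exact hm.syzygy_zero hf hfg hg
  | succ m => exact hm.syzygy hf hfg hg

/-! ### Induction along the regular sequence -/

/-- Reduction modulo one regular element preserves and reflects property (TG). -/
theorem IsReduction.propertyTG_iff {R S : Type u} [CommRing R] [CommRing S] [Algebra R S] {x : R}
    [IsNoetherianRing R] (hS : IsReduction x (Algebra.linearMap R S))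
    (hx : x ∈ Ideal.jacobson (⊥ : Ideal R)) : PropertyTG R ↔ PropertyTG S :=
  ⟨hS.propertyTG, IsReduction.propertyTG_of_reduction hS hx⟩

/-- Both rings are the reduction of `R⟦X⟧` modulo `X`. -/
theorem PropertyTG.congr {R S : Type u} [CommRing R] [IsNoetherianRing R] [CommRing S]
    (e : R ≃+* S) : PropertyTG R ↔ PropertyTG S := by
  have key : ∀ (T : Type u) [CommRing T] (e : R ≃+* T),
      PropertyTG (PowerSeries R) ↔ PropertyTG T := by
    intro T _ e
    let : Algebra (PowerSeries R) T := (e.toRingHom.comp PowerSeries.constantCoeff).toAlgebra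
    have h0 : ∀ p : PowerSeries R, algebraMap (PowerSeries R) T p =
        e (PowerSeries.constantCoeff p) :=
      fun _ => rfl
    refine IsReduction.propertyTG_iff (x := PowerSeries.X) ⟨?_, ?_, ?_⟩ ?_
    · intro p q h
      exact PowerSeries.X_mul_cancel h
    · intro p
      rw [Algebra.linearMap_apply, h0, EmbeddingLike.map_eq_zero_iff, ← PowerSeries.X_dvd_iff]
      exact ⟨fun ⟨q, hq⟩ => ⟨q, hq.symm⟩, fun ⟨q, hq⟩ => ⟨q, hq.symm⟩⟩
    · intro t
      exact ⟨PowerSeries.C (e.symm t), by simp [h0]⟩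
    · rw [Ideal.mem_jacobson_bot]
      intro p
      simp [PowerSeries.isUnit_iff_constantCoeff]
  exact (key R (RingEquiv.refl R)).symm.trans (key S e)

theorem IsReduction.quotient_span {R : Type*} [CommRing R] {x : R} (hx : IsSMulRegular R x) :
    IsReduction x (Algebra.linearMap R (R ⧸ Ideal.span {x})) where
  regular := hx
  exact r := by
    rw [Algebra.linearMap_apply, Ideal.Quotient.algebraMap_eq, Ideal.Quotient.eq_zero_iff_mem,
      Ideal.mem_span_singleton]
    exact ⟨fun ⟨s, hs⟩ => ⟨s, hs.symm⟩, fun ⟨s, hs⟩ => ⟨s, hs.symm⟩⟩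
  surjective := Ideal.Quotient.mk_surjective

open RingTheory.Sequence in
theorem RingTheory.Sequence.IsWeaklyRegular.quotient_span {R : Type*} [CommRing R] {a : R}
    {as : List R}
    (h : IsWeaklyRegular R (a :: as)) : IsWeaklyRegular (R ⧸ Ideal.span {a})
      (as.map (Ideal.Quotient.mk (Ideal.span {a}))) := by
  have h' := ((isWeaklyRegular_cons_iff R a as).1 h).2
  refine (isWeaklyRegular_map_algebraMap_iff (R ⧸ Ideal.span {a}) _ as).2 ?_
  refine (LinearEquiv.isWeaklyRegular_congr (Submodule.quotEquivOfEq _ _ ?_) as).1 h'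
  rw [← Submodule.ideal_span_singleton_smul, smul_eq_mul, Ideal.mul_top]

/-- With the last quotient given only as a surjection with prescribed kernel, the induction can
replace `R` by `R/(a)` without identifying iterated quotients. Nontriviality of `S` makes each entry
a non-unit. -/
theorem propertyTG_iff_of_isWeaklyRegular {R : Type u} [CommRing R] [IsNoetherianRing R]
    [IsLocalRing R] (x : List R) (hx : RingTheory.Sequence.IsWeaklyRegular R x) {S : Type u}
    [CommRing S] [Nontrivial S] (φ : R →+* S) (hφ : Function.Surjective φ)
    (hker : RingHom.ker φ = Ideal.ofList x) : PropertyTG R ↔ PropertyTG S := by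
  induction hn : x.length generalizing R with
  | zero =>
    rw [List.length_eq_zero_iff] at hn
    rw [hn, Ideal.ofList_nil] at hker
    exact PropertyTG.congr (RingEquiv.ofBijective φ
      ⟨(RingHom.injective_iff_ker_eq_bot φ).2 hker, hφ⟩)
  | succ n ih =>
    obtain ⟨a, as, rfl⟩ := List.exists_cons_of_length_eq_add_one hn
    have hk : Ideal.span {a} ≤ RingHom.ker φ := by
      rw [hker, Ideal.ofList_cons]
      exact le_sup_left
    let ψ : R ⧸ Ideal.span {a} →+* S := Ideal.Quotient.lift _ φ hk
    have hψ : Function.Surjective ψ := Ideal.Quotient.lift_surjective_of_surjective _ _ hφ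
    have : Nontrivial (R ⧸ Ideal.span {a}) := ψ.domain_nontrivial
    have : IsLocalRing (R ⧸ Ideal.span {a}) :=
      IsLocalRing.of_surjective' _ Ideal.Quotient.mk_surjective
    have ha : a ∈ Ideal.jacobson (⊥ : Ideal R) := by
      rw [IsLocalRing.jacobson_eq_maximalIdeal _ bot_ne_top, IsLocalRing.mem_maximalIdeal]
      intro hu
      have h0 : φ a = 0 := hk (Ideal.mem_span_singleton_self a)
      exact not_isUnit_zero (h0 ▸ hu.map φ)
    rw [(IsReduction.quotient_span
      ((RingTheory.Sequence.isWeaklyRegular_cons_iff R a as).1 hx).1).propertyTG_iff ha]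
    refine ih _ hx.quotient_span ψ hψ ?_ (by simpa using hn)
    rw [← Ideal.map_ofList, Ideal.ker_quotient_lift, hker, Ideal.ofList_cons, Ideal.map_sup,
      Ideal.map_quotient_self, bot_sup_eq]

theorem proposition3p1 (R : Type u) [CommRing R] [IsNoetherianRing R] [IsLocalRing R]
    (x : List R) (hx : RingTheory.Sequence.IsRegular R x) :
    PropertyTG R ↔ PropertyTG (R ⧸ Ideal.ofList x) := by
  have h : Ideal.ofList x ≠ ⊤ := fun h => hx.top_ne_smul (by rw [h, smul_eq_mul, Ideal.mul_top])
  have : Nontrivial (R ⧸ Ideal.ofList x) := Ideal.Quotient.nontrivial_iff.2 h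
  exact propertyTG_iff_of_isWeaklyRegular x hx.toIsWeaklyRegular (Ideal.Quotient.mk _)
    Ideal.Quotient.mk_surjective Ideal.mk_ker
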